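/- Let $\mathsf T$ be an essentially small triangulated category. Write $\mathbf A(\mathsf T)$ for its abelianisation, that is, the full subcategory of the category of functors $\mathsf T^{\mathrm{op}}\to\mathsf{Ab}$ whose objects are the additive functors $F$ that fit into an exact sequence \[\operatorname{Hom}_{\mathsf T}(-,X)\longrightarrow\operatorname{Hom}_{\mathsf T}(-,Y)\longrightarrow F\longrightarrow 0\] with $X,Y$ in $\mathsf T$. Suppose that $\mathsf T$ is locally noetherian, that is, idempotents in $\mathsf T$ split and every object of $\mathbf A(\mathsf T)$ is noetherian (every ascending chain of subobjects in $\mathbf A(\mathsf T)$ eventually stabilises). Then for each thick subcategory $\mathsf U$ of $\mathsf T$ (a full triangulated subcategory closed under direct summands) the inclusion functor $\mathsf U\to\mathsf T$ admits a right adjoint. -/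

import Mathlib

universe w v u

namespace CategoryTheory

open Limits

section

variable (T : Type u) [Category.{v} T] [Preadditive T]

/-- A functor `F : Tᵒᵖ ⥤ Ab` belongs to the abelianisation of `T` if it is additive and fits into
an exact sequence `Hom(-, X) ⟶ Hom(-, Y) ⟶ F ⟶ 0` of functors `Tᵒᵖ ⥤ Ab`. -/
def isFinitelyPresentedFunctor : ObjectProperty (Tᵒᵖ ⥤ AddCommGrpCat.{v}) :=
  fun F => F.Additive ∧
    ∃ (X Y : T) (g : preadditiveYoneda.obj X ⟶ preadditiveYoneda.obj Y)
      (p : preadditiveYoneda.obj Y ⟶ F) (w : g ≫ p = 0),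
      (ShortComplex.mk g p w).Exact ∧ Epi p

/-- The abelianisation `A(T)`: the full subcategory of the category of functors `Tᵒᵖ ⥤ Ab`
consisting of the additive functors `F` that fit into an exact sequence
`Hom(-, X) ⟶ Hom(-, Y) ⟶ F ⟶ 0`. -/
abbrev Abelianisation := (isFinitelyPresentedFunctor T).FullSubcategory

/-- `T` is locally noetherian if idempotents in `T` split and every object of the abelianisation
`A(T)` is noetherian, i.e. satisfies the ascending chain condition on subobjects in `A(T)`. -/
structure IsLocallyNoetherian : Prop where
  idempotents_split : IsIdempotentComplete T
  isNoetherianObject : ∀ F : Abelianisation T, IsNoetherianObject F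

end

section

variable {T : Type u} [Category.{v} T] [HasZeroObject T] [HasShift T ℤ] [Preadditive T]
  [∀ n : ℤ, (shiftFunctor T n).Additive] [Pretriangulated T]

/-- A (full) subcategory of a triangulated category, given by the property `P` of objects, is thick
if it is a triangulated subcategory (it contains a zero object, is stable under all shifts and is
closed under extensions in distinguished triangles) which is closed under direct summands, hence in
particular under isomorphisms. -/
structure IsThickSubcategory (P : ObjectProperty T) : Prop where
  isTriangulated : P.IsTriangulated
  isStableUnderRetracts : P.IsStableUnderRetracts

end

end CategoryTheory

namespace CategoryTheory

open Category Limits Preadditive Pretriangulated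

/-! Morphisms to `X` from objects of `U` are compared through their images in `Hom(-, X)`, which lie
in `A(T)` because `T` has weak kernels. Biproducts make this family of images directed, so
noetherianity gives a largest one: a `U`-precover of `X` (`exists_isPrecover`). Lifts through a
precover `f` need not be unique. Precovering the weak kernel of `f` as well yields an idempotent on
the source that fixes `f` and kills every map from `U` that `f` kills; splitting it gives the
coreflection (`exists_coreflection`). -/

/-- A short complex of functors with values in abelian groups is exact if it is so pointwise. -/
lemma exact_of_forall_evaluation {C : Type u} [Category.{v} C]
    (S : ShortComplex (C ⥤ AddCommGrpCat.{v}))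
    (h : ∀ X : C, (S.map ((evaluation C AddCommGrpCat.{v}).obj X)).Exact) : S.Exact := by
  rw [ShortComplex.exact_iff_isZero_homology]
  refine (Functor.isZero_iff _).2 fun X => ?_
  exact IsZero.of_iso ((ShortComplex.exact_iff_isZero_homology _).1 (h X))
    (S.mapHomologyIso ((evaluation C AddCommGrpCat.{v}).obj X)).symm

/-- A morphism `f : Y ⟶ X` with `Y` in `P` is a `P`-precover if each morphism to `X` from an object
of `P` factors through `f`. -/
structure IsPrecover {T : Type u} [Category.{v} T] (P : ObjectProperty T) {X Y : T} (f : Y ⟶ X) :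
    Prop where
  prop : P Y
  exists_lift : ∀ {A : T}, P A → ∀ a : A ⟶ X, ∃ b : A ⟶ Y, b ≫ f = a

section Images

variable {T : Type u} [Category.{v} T] [Preadditive T]

lemma additive_of_mono {F G : Tᵒᵖ ⥤ AddCommGrpCat.{v}} (i : F ⟶ G) [Mono i] [G.Additive] :
    F.Additive where
  map_add {X Y f g} := by
    rw [← cancel_mono (i.app Y)]
    simp only [NatTrans.naturality, Functor.map_add, comp_add, add_comp]

/-- A quotient `F` of `Hom(-, Y)` which embeds in `Hom(-, X)` is finitely presented as soon as
the corresponding morphism `Y ⟶ X` has a weak kernel. -/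
lemma isFinitelyPresentedFunctor_of_weakKernel {X Y Z : T} (f : Y ⟶ X) (k : Z ⟶ Y)
    (hk : k ≫ f = 0) (hk' : ∀ {A : T} (a : A ⟶ Y), a ≫ f = 0 → ∃ b : A ⟶ Z, b ≫ k = a)
    {F : Tᵒᵖ ⥤ AddCommGrpCat.{v}} (p : preadditiveYoneda.obj Y ⟶ F) [Epi p]
    (i : F ⟶ preadditiveYoneda.obj X) [Mono i] (hpi : p ≫ i = preadditiveYoneda.map f) :
    isFinitelyPresentedFunctor T F := by
  have w : preadditiveYoneda.map k ≫ p = 0 := by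
    rw [← cancel_mono i, assoc, hpi, ← Functor.map_comp, hk, Functor.map_zero, zero_comp]
  refine ⟨additive_of_mono i, Z, Y, preadditiveYoneda.map k, p, w, ?_, inferInstance⟩
  refine exact_of_forall_evaluation _ fun A => ?_
  rw [ShortComplex.ab_exact_iff]
  intro (a : A.unop ⟶ Y) (ha : (p.app A).hom a = 0)
  have h : a ≫ f = 0 := by
    have := congr_arg (fun φ => (φ.app A).hom a) hpi
    dsimp at this
    exact this.symm.trans ((congr_arg (i.app A).hom ha).trans (map_zero _))
  obtain ⟨b, hb⟩ := hk' a h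
  exact ⟨b, hb⟩

end Images

section Precovers

variable {T : Type u} [Category.{v} T] [HasZeroObject T] [HasShift T ℤ] [Preadditive T]
  [∀ n : ℤ, (shiftFunctor T n).Additive] [Pretriangulated T]

/-- The fibre of `f` works, by exactness of `Hom(A, -)` on triangles. -/
lemma exists_weakKernel {X Y : T} (f : Y ⟶ X) : ∃ (Z : T) (k : Z ⟶ Y), k ≫ f = 0 ∧
    ∀ {A : T} (a : A ⟶ Y), a ≫ f = 0 → ∃ b : A ⟶ Z, b ≫ k = a := by
  obtain ⟨Z, k, h, hT⟩ := distinguished_cocone_triangle₁ f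
  refine ⟨Z, k, comp_distTriang_mor_zero₁₂ _ hT, fun a ha => ?_⟩
  obtain ⟨b, hb⟩ := Triangle.coyoneda_exact₂ _ hT a ha
  exact ⟨b, hb.symm⟩

/-- The functor `Hom(-, X)` as an object of the abelianisation. -/
def Abelianisation.yoneda (X : T) : Abelianisation T where
  obj := preadditiveYoneda.obj X
  property := by
    obtain ⟨Z, k, hk, hk'⟩ := exists_weakKernel (𝟙 X)
    exact isFinitelyPresentedFunctor_of_weakKernel (𝟙 X) k hk hk'
      (𝟙 (preadditiveYoneda.obj X)) (𝟙 _) (by simp)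

/-- The image of `Hom(-, Y) ⟶ Hom(-, X)` as an object of the abelianisation. -/
noncomputable def Abelianisation.image {X Y : T} (f : Y ⟶ X) : Abelianisation T where
  obj := Limits.image (preadditiveYoneda.map f)
  property := by
    obtain ⟨Z, k, hk, hk'⟩ := exists_weakKernel f
    exact isFinitelyPresentedFunctor_of_weakKernel f k hk hk'
      (factorThruImage (preadditiveYoneda.map f)) (image.ι _) (image.fac _)

/-- The inclusion of the image of `Hom(-, Y) ⟶ Hom(-, X)` into `Hom(-, X)`. -/
noncomputable def Abelianisation.imageι {X Y : T} (f : Y ⟶ X) :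
    Abelianisation.image f ⟶ Abelianisation.yoneda X :=
  ObjectProperty.homMk (Limits.image.ι (preadditiveYoneda.map f))

instance {X Y : T} (f : Y ⟶ X) : Mono (Abelianisation.imageι f) :=
  (isFinitelyPresentedFunctor T).ι.mono_of_mono_map
    (inferInstanceAs (Mono (Limits.image.ι (preadditiveYoneda.map f))))

/-- The image of `Hom(-, Y) ⟶ Hom(-, X)` as a subobject in the abelianisation. -/
noncomputable def Abelianisation.imageSubobject {X Y : T} (f : Y ⟶ X) :
    Subobject (Abelianisation.yoneda X) :=
  Subobject.mk (Abelianisation.imageι f)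

/-- The inclusion of images corresponds to factorisations, as `Hom(-, Y)` is projective. -/
lemma Abelianisation.imageSubobject_le_iff {X Y Y' : T} (f : Y ⟶ X) (f' : Y' ⟶ X) :
    imageSubobject f ≤ imageSubobject f' ↔ ∃ a : Y ⟶ Y', a ≫ f' = f := by
  constructor
  · intro h
    let φ := (Subobject.ofMkLEMk _ _ h).hom
    have hφ : φ ≫ image.ι (preadditiveYoneda.map f') = image.ι (preadditiveYoneda.map f) :=
      congr_arg (fun ψ => ψ.hom) (Subobject.ofMkLEMk_comp h)
    let y := (φ.app (Opposite.op Y)).hom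
      (((factorThruImage (preadditiveYoneda.map f)).app (Opposite.op Y)).hom (𝟙 Y))
    obtain ⟨a, ha⟩ : ∃ a : Y ⟶ Y',
        ((factorThruImage (preadditiveYoneda.map f')).app (Opposite.op Y)).hom a = y :=
      (AddCommGrpCat.epi_iff_surjective
        ((factorThruImage (preadditiveYoneda.map f')).app (Opposite.op Y))).1 inferInstance y
    refine ⟨a, ?_⟩
    have h₁ : ((image.ι (preadditiveYoneda.map f')).app (Opposite.op Y)).hom y = 𝟙 Y ≫ f := by
      have := congr_arg (fun ψ => (ψ.app (Opposite.op Y)).hom (𝟙 Y))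
        ((congr_arg (factorThruImage (preadditiveYoneda.map f) ≫ ·) hφ).trans (image.fac _))
      exact this
    have h₂ : ((image.ι (preadditiveYoneda.map f')).app (Opposite.op Y)).hom y = a ≫ f' := by
      rw [← ha]
      exact congr_arg (fun ψ => (ψ.app (Opposite.op Y)).hom a)
        (image.fac (preadditiveYoneda.map f'))
    rw [← h₂, h₁, id_comp]
  · rintro ⟨a, rfl⟩
    let F : MonoFactorisation (preadditiveYoneda.map (a ≫ f')) :=
      { I := Limits.image (preadditiveYoneda.map f')
        m := image.ι _
        e := preadditiveYoneda.map a ≫ factorThruImage _ }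
    refine Subobject.mk_le_mk_of_comm (ObjectProperty.homMk (image.lift F)) ?_
    ext1
    exact image.lift_fac F

/-- A noetherian functor `Hom(-, X)` admits precovers with respect to triangulated subcategories. -/
lemma exists_isPrecover (P : ObjectProperty T) [P.IsTriangulated] [P.IsClosedUnderIsomorphisms]
    (X : T) [IsNoetherianObject (Abelianisation.yoneda X)] :
    ∃ (Y : T) (f : Y ⟶ X), IsPrecover P f := by
  let s : Set (Subobject (Abelianisation.yoneda X)) :=
    { x | ∃ (Y : T) (f : Y ⟶ X), P Y ∧ Abelianisation.imageSubobject f = x }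
  obtain ⟨O, -, hO⟩ := P.exists_prop_of_containsZero
  obtain ⟨_, ⟨Y, f, hY, rfl⟩, hmax⟩ := WellFounded.has_min
    (wellFounded_gt (α := Subobject (Abelianisation.yoneda X))) s ⟨_, O, 0, hO, rfl⟩
  refine ⟨Y, f, hY, fun {A} hA a => ?_⟩
  -- The source `Y ⊞ A` stays in `P`, so by maximality adjoining `a` does not enlarge the image, and
  -- `a` factors through `f`.
  have hle : Abelianisation.imageSubobject f ≤
      Abelianisation.imageSubobject (biprod.desc f a) :=
    (Abelianisation.imageSubobject_le_iff _ _).2 ⟨biprod.inl, by simp⟩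
  have heq := eq_of_le_of_not_lt hle
    (hmax _ ⟨_, biprod.desc f a,
      P.ext_of_isTriangulatedClosed₂ _ (binaryBiproductTriangle_distinguished Y A) hY hA, rfl⟩)
  obtain ⟨b, hb⟩ := (Abelianisation.imageSubobject_le_iff _ _).1 heq.ge
  exact ⟨biprod.inr ≫ b, by rw [assoc, hb, biprod.inr_desc]⟩

/-- If idempotents split and each object has a precover with respect to a thick subcategory,
then each object has a coreflection in this subcategory. -/
lemma exists_coreflection [IsIdempotentComplete T] (P : ObjectProperty T)
    (hP : IsThickSubcategory P)
    (hcov : ∀ X : T, ∃ (Y : T) (f : Y ⟶ X), IsPrecover P f) (X : T) :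
    ∃ (E : T) (f : E ⟶ X), P E ∧ ∀ {A : T}, P A → ∀ a : A ⟶ X, ∃! b : A ⟶ E, b ≫ f = a := by
  have := hP.isTriangulated
  have := hP.isStableUnderRetracts
  obtain ⟨S, f, hf⟩ := hcov X
  obtain ⟨Z, k, hk, hk'⟩ := exists_weakKernel f
  obtain ⟨S', c, hc⟩ := hcov Z
  -- `h` kills every map from `P` that `f` kills: such a map factors through `k`, then through `c`.
  obtain ⟨C, h, δ, hT⟩ := distinguished_cocone_triangle (c ≫ k)
  have hC : P C := P.ext_of_isTriangulatedClosed₃ _ hT hc.prop hf.prop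
  have hh : (c ≫ k) ≫ h = 0 := comp_distTriang_mor_zero₁₂ _ hT
  have zero_comp_h {A : T} (hA : P A) (a : A ⟶ S) (ha : a ≫ f = 0) : a ≫ h = 0 := by
    obtain ⟨b, rfl⟩ := hk' a ha
    obtain ⟨b, rfl⟩ := hc.exists_lift hA b
    rw [assoc b, assoc b, hh, comp_zero]
  obtain ⟨f', hf'⟩ : ∃ f' : C ⟶ X, f = h ≫ f' :=
    Triangle.yoneda_exact₂ _ hT f (by
      change (c ≫ k) ≫ f = 0
      rw [assoc, hk, comp_zero])
  obtain ⟨r, hr⟩ := hf.exists_lift hC f'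
  have hrf : (h ≫ r) ≫ f = f := by rw [assoc, hr, ← hf']
  -- `𝟙 S - h ≫ r` is killed by `f`, hence by `h`; this makes `h ≫ r` idempotent.
  have hrh : (h ≫ r) ≫ h = h := by
    have := zero_comp_h hf.prop (𝟙 S - h ≫ r) (by rw [sub_comp, hrf, id_comp, sub_self])
    rw [sub_comp, id_comp, sub_eq_zero] at this
    exact this.symm
  obtain ⟨E, i, p, hip, hpi⟩ := IsIdempotentComplete.idempotents_split S (h ≫ r)
    (by rw [← assoc, hrh])
  refine ⟨E, i ≫ f, P.prop_of_retract ⟨i, p, hip⟩ hf.prop, fun {A} hA a => ?_⟩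
  obtain ⟨b, hb⟩ := hf.exists_lift hA a
  refine ⟨b ≫ p, ?_, fun b' hb' => ?_⟩
  · dsimp only
    rw [assoc, ← assoc p, hpi, hrf, hb]
  -- Two lifts to `S` agree after `h`, hence after the idempotent `h ≫ r`.
  · have : (b' ≫ i - b) ≫ h = 0 :=
      zero_comp_h hA _ (by rw [sub_comp, assoc, hb', hb, sub_self])
    rw [sub_comp, sub_eq_zero] at this
    calc b' = ((b' ≫ i) ≫ (h ≫ r)) ≫ p := by
            rw [← hpi]; simp only [assoc, hip, comp_id]
      _ = (b ≫ (h ≫ r)) ≫ p := by rw [← assoc (b' ≫ i), this, assoc b]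
      _ = b ≫ p := by rw [← hpi]; simp only [assoc, hip, comp_id]

end Precovers

/-- The inclusion of a full subcategory has a right adjoint if each object has a coreflection. -/
lemma isLeftAdjoint_ι_of_exists_coreflection {C : Type u} [Category.{v} C] (P : ObjectProperty C)
    (h : ∀ X : C, ∃ (E : C) (f : E ⟶ X), P E ∧
      ∀ {A : C}, P A → ∀ a : A ⟶ X, ∃! b : A ⟶ E, b ≫ f = a) : P.ι.IsLeftAdjoint := by
  rw [isLeftAdjoint_iff_hasTerminal_costructuredArrow]
  intro X
  obtain ⟨E, f, hE, hf⟩ := h X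
  let t : CostructuredArrow P.ι X := CostructuredArrow.mk (Y := (⟨E, hE⟩ : P.FullSubcategory)) f
  have ht (x : CostructuredArrow P.ι X) : Nonempty (Unique (x ⟶ t)) := by
    obtain ⟨b, hb, hb'⟩ := hf x.left.property x.hom
    refine ⟨⟨⟨CostructuredArrow.homMk (ObjectProperty.homMk b) hb⟩, fun φ => ?_⟩⟩
    apply CostructuredArrow.hom_ext
    ext1
    exact hb' _ (CostructuredArrow.w φ)
  have := fun x => (ht x).some
  exact (IsTerminal.ofUnique t).hasTerminal

end CategoryTheory

theorem theorem2p4 {T : Type u} [CategoryTheory.Category.{v} T]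
    [CategoryTheory.Limits.HasZeroObject T] [CategoryTheory.HasShift T ℤ]
    [CategoryTheory.Preadditive T]
    [∀ n : ℤ, (CategoryTheory.shiftFunctor T n).Additive]
    [CategoryTheory.Pretriangulated T] [CategoryTheory.IsTriangulated T]
    [CategoryTheory.EssentiallySmall.{w} T]
    (hT : CategoryTheory.IsLocallyNoetherian T)
    (U : CategoryTheory.ObjectProperty T) (hU : CategoryTheory.IsThickSubcategory U) :
    U.ι.IsLeftAdjoint := by
  have := hT.idempotents_split
  have := hU.isTriangulated
  have := hU.isStableUnderRetracts
  refine CategoryTheory.isLeftAdjoint_ι_of_exists_coreflection U fun X =>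
    CategoryTheory.exists_coreflection U hU (fun X => ?_) X
  have := hT.isNoetherianObject (CategoryTheory.Abelianisation.yoneda X)
  exact CategoryTheory.exists_isPrecover U X
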